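/- Let $\ell\in\mathbb N$, let $\varphi_\ell(\kappa)=\kappa^\ell-\sum_{j=1}^{\ell-1}c_j\kappa^j$ with real $c_j$, and let $\alpha_1\neq\alpha_2$ be real numbers such that for $k=1,2$ the spectral curve $\varphi_\ell(\kappa)-\alpha_k=0$ has $\ell$ distinct real roots $\kappa_1[\alpha_k]<\dots<\kappa_\ell[\alpha_k]$. Let $\mathcal I_k\subseteq\{1,\dots,\ell\}$ with $|\mathcal I_k|=m_k$, let $M=m_1+m_2$, and let $\kappa_1<\dots<\kappa_M$ be the numbers $\kappa_j[\alpha_k]$ ($j\in\mathcal I_k$, $k=1,2$) in increasing order. Let $\phi$ be the resulting bijection from the disjoint union $\mathcal I_1\sqcup\mathcal I_2$ onto $[M]=\{1,\dots,M\}$, so $\kappa_{\phi(j,k)}=\kappa_j[\alpha_k]$; we use the elements of $\mathcal I_k$ in increasing order as column indices of an $n\times m_k$ matrix. *Matrices and permutations.* For a real $N\times M$ matrix $A$ and $I=\{i_1<\dots<i_N\}\subseteq[M]$ let $\Delta_I(A)$ be the corresponding maximal minor, and $\mathcal M(A)=\{I:\Delta_I(A)\ne0\}$. $A$ is totally nonnegative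 if it has rank $N$ and $\Delta_I(A)>0$ for all $I\in\mathcal M(A)$. If $v_1,\dots,v_M$ are the columns of $A$, then $\pi(A)\in S_M$ is the permutation for which $\pi(A)(j)$ is the first index $i$ in the cyclic list $j-1,j-2,\dots,j-M=j$ (indices mod $M$) with $v_j\in\operatorname{span}(v_{j-1},v_{j-2},\dots,v_i)$, and $\pi(A)(j)=j$ if $v_j=0$. *Dominant exponentials.* Let $\mathbf t=(t_1,t_2,t_3,\dots)$ with $t_1=x$, $t_2=y$, and let $E_j(\mathbf t)=\exp\big(\sum_{n\ge1}\kappa_j^nt_n\big)$. The solution generated by $(\kappa,A)$ has the $\tau$-function $\tau=\sum_{I\in\mathcal M(A)}\Delta_I(A)E_I(\mathbf t)$ with $E_I=\prod_{k>l}(\kappa_{i_k}-\kappa_{i_l})\prod_{k}E_{i_k}$. For fixed $t_3,t_4,\dots$, the exponential $E_I$, $I\in\mathcal M(A)$, is called *dominant* if there is a nonempty open sector of the $xy$-plane with apex $0$ in which, as $x^2+y^2\to\infty$, $\Delta_J(A)E_J=o(\Delta_I(A)E_I)$ for every $J\in\mathcal M(A)$ with $J\ne I$. *Claim.* For $k=1,2$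 let $A[\alpha_k]$ be a totally nonnegative $n_k\times m_k$ matrix whose permutation $\pi(A[\alpha_k])$ is a derangement (has no fixed point). Let $A[\alpha_1]\hat\oplus A[\alpha_2]$ be their $\kappa$-direct sum: the $(n_1+n_2)\times M$ matrix whose column $\phi(j,k)$ consists of column $j$ of $A[\alpha_k]$ in the $n_k$ rows assigned to $A[\alpha_k]$ and of zeros in the other rows, for any assignment of the rows (for matrices in reduced row echelon form, in particular the one that makes the direct sum again reduced row echelon). Let $A[\alpha_1,\alpha_2]$ be a totally nonnegative $(n_1+n_2)\times M$ matrix with $\pi(A[\alpha_1,\alpha_2])=\pi(A[\alpha_1])\cdot\pi(A[\alpha_2])$, where $\pi(A[\alpha_k])$ acts on $\phi(\mathcal I_k)$ through $\phi$ and trivially on the rest of $[M]$. Then, for all fixed $t_3,t_4,\dots$ for which the series $\sum_{n\ge3}\kappa_j^nt_n$ converge absolutely, the set of dominant exponentials of the solution generated by $(\kappa,A[\alpha_1,\alpha_2])$ equals the set of dominant exponentials of the solution generated by $(\kappa,A[\alpha_1]\hat\oplus A[\alpha_2])$. -/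

import Mathlib

open Filter Topology Polynomial

namespace KPSoliton

/-! ### The spectral curve -/

/-- The spectral curve of the `ℓ`-reduction,
`Φ_ℓ(κ, α) = κ^ℓ - ∑_{j=1}^{ℓ-1} c_j κ^j - α`, as a polynomial in `κ`. -/
noncomputable def spectralCurve (ℓ : ℕ) (c : ℕ → ℝ) (α : ℝ) : ℝ[X] :=
  X ^ ℓ - ∑ j ∈ Finset.Icc 1 (ℓ - 1), C (c j) * X ^ j - C α

/-- `r` lists the roots of `Φ_ℓ(κ, α) = 0` in increasing order: there are `ℓ` distinct real
roots and `Φ_ℓ(κ, α) = ∏ (κ - r_j)`. -/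
def IsOrderedRoots (ℓ : ℕ) (c : ℕ → ℝ) (α : ℝ) (r : Fin ℓ → ℝ) : Prop :=
  StrictMono r ∧ spectralCurve ℓ c α = ∏ j, (X - C (r j))

/-! ### Minors and the totally nonnegative Grassmannian

A point of `Gr(N, M)` is represented by a real `N × M` matrix of rank `N`; an index set
`I = {i_1 < ⋯ < i_N} ⊆ [M]` is an order embedding `Fin N ↪o Fin M`. -/

/-- The maximal minor `Δ_I(A)`. -/
noncomputable def minor {N M : ℕ} (A : Matrix (Fin N) (Fin M) ℝ) (I : Fin N ↪o Fin M) : ℝ :=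
  (A.submatrix id I).det

/-- The matroid `𝓜(A)` of `A`. -/
def matroid {N M : ℕ} (A : Matrix (Fin N) (Fin M) ℝ) : Set (Fin N ↪o Fin M) :=
  {I | minor A I ≠ 0}

/-- `A` represents a point of the totally nonnegative Grassmannian `Gr(N, M)_{≥ 0}`. -/
def IsTotallyNonneg {N M : ℕ} (A : Matrix (Fin N) (Fin M) ℝ) : Prop :=
  A.rank = N ∧ ∀ I ∈ matroid A, 0 < minor A I

/-! ### The permutation of a matrix -/

section Perm

variable {ι : Type*} {N : ℕ}

/-- The span of the `k` columns `v_{c j}, v_{c² j}, …, v_{c^k j}` of `A`. -/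
def windowSpan (A : Matrix (Fin N) ι ℝ) (c : Equiv.Perm ι) (j : ι) (k : ℕ) :
    Submodule ℝ (Fin N → ℝ) :=
  Submodule.span ℝ ((fun r : ℕ => A.transpose ((c ^ (r + 1)) j)) '' Set.Iio k)

theorem windowSpan_mono (A : Matrix (Fin N) ι ℝ) (c : Equiv.Perm ι) (j : ι) :
    Monotone (windowSpan A c j) := fun _ _ h =>
  Submodule.span_mono (Set.image_mono (Set.Iio_subset_Iio h))

theorem exists_mem_windowSpan [Finite ι] (A : Matrix (Fin N) ι ℝ) (c : Equiv.Perm ι) (j : ι) :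
    ∃ k, A.transpose j ∈ windowSpan A c j k := by
  refine ⟨orderOf c, Submodule.subset_span ⟨orderOf c - 1, ?_, ?_⟩⟩
  · have := orderOf_pos c
    simp only [Set.mem_Iio]; omega
  · have := orderOf_pos c
    have h : orderOf c - 1 + 1 = orderOf c := by omega
    simp [h, pow_orderOf_eq_one]

open Classical in
/-- The least `k` with `v_j ∈ span(v_{c j}, …, v_{c^k j})`. -/
noncomputable def firstIndex [Finite ι] (A : Matrix (Fin N) ι ℝ) (c : Equiv.Perm ι) (j : ι) : ℕ :=
  Nat.find (exists_mem_windowSpan A c j)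

theorem firstIndex_spec [Finite ι] (A : Matrix (Fin N) ι ℝ) (c : Equiv.Perm ι) (j : ι) :
    A.transpose j ∈ windowSpan A c j (firstIndex A c j) := by
  classical
  exact Nat.find_spec (exists_mem_windowSpan A c j)

theorem firstIndex_eq [Finite ι] (A : Matrix (Fin N) ι ℝ) (c : Equiv.Perm ι) (j : ι) (k : ℕ)
    (h : A.transpose j ∈ windowSpan A c j k)
    (h' : ∀ p < k, A.transpose j ∉ windowSpan A c j p) : firstIndex A c j = k := by
  classical
  exact (Nat.find_eq_iff (exists_mem_windowSpan A c j)).2 ⟨h, h'⟩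

/-- The element `c^k j` for the least `k` with `v_j ∈ span(v_{c j}, …, v_{c^k j})`. -/
noncomputable def firstElement [Finite ι] (A : Matrix (Fin N) ι ℝ) (c : Equiv.Perm ι) (j : ι) : ι :=
  (c ^ firstIndex A c j) j

theorem windowSpan_succ (A : Matrix (Fin N) ι ℝ) (c : Equiv.Perm ι) (j : ι) (p : ℕ) :
    windowSpan A c j (p + 1) = Submodule.span ℝ (insert (A.transpose ((c ^ (p + 1)) j))
      ((fun r : ℕ => A.transpose ((c ^ (r + 1)) j)) '' Set.Iio p)) := by
  have : Set.Iio (p + 1) = insert p (Set.Iio p) := by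
    ext r; simp only [Set.mem_Iio, Set.mem_insert_iff]; omega
  rw [windowSpan, this, Set.image_insert_eq]

theorem window_reverse (A : Matrix (Fin N) ι ℝ) (c : Equiv.Perm ι) (j : ι) (p : ℕ) :
    (fun r : ℕ => A.transpose ((c⁻¹ ^ (r + 1)) ((c ^ (p + 1)) j))) '' Set.Iio p =
      (fun r : ℕ => A.transpose ((c ^ (r + 1)) j)) '' Set.Iio p := by
  have key : ∀ r < p, (c⁻¹ ^ (r + 1)) ((c ^ (p + 1)) j) = (c ^ (p - 1 - r + 1)) j := by
    intro r hr
    rw [← Equiv.Perm.mul_apply]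
    congr 1
    rw [inv_pow, inv_mul_eq_iff_eq_mul, ← pow_add]
    congr 1; omega
  ext v
  constructor
  · rintro ⟨r, hr, rfl⟩
    simp only [Set.mem_Iio] at hr
    exact ⟨p - 1 - r, by simp only [Set.mem_Iio]; omega, by simp only [key r hr]⟩
  · rintro ⟨r, hr, rfl⟩
    simp only [Set.mem_Iio] at hr
    refine ⟨p - 1 - r, by simp only [Set.mem_Iio]; omega, ?_⟩
    have h : p - 1 - (p - 1 - r) + 1 = r + 1 := by omega
    simp only [key (p - 1 - r) (by omega), h]

theorem firstElement_inv [Finite ι] (A : Matrix (Fin N) ι ℝ) (c : Equiv.Perm ι) (j : ι) :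
    firstElement A c⁻¹ (firstElement A c j) = j := by
  classical
  have hspec := firstIndex_spec A c j
  have hmin : ∀ p < firstIndex A c j, A.transpose j ∉ windowSpan A c j p := fun p hp =>
    Nat.find_min (exists_mem_windowSpan A c j) hp
  unfold firstElement
  generalize firstIndex A c j = k at hspec hmin ⊢
  have hback : ∀ q, (c⁻¹ ^ q) ((c ^ q) j) = j := by
    intro q; rw [← Equiv.Perm.mul_apply, inv_pow, inv_mul_cancel, Equiv.Perm.one_apply]
  suffices h : firstIndex A c⁻¹ ((c ^ k) j) = k by rw [h, hback]
  cases k with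
  | zero =>
    refine firstIndex_eq _ _ _ _ ?_ (by simp)
    simpa [windowSpan] using hspec
  | succ p =>
    have hnot := hmin p (Nat.lt_succ_self p)
    rw [windowSpan_succ] at hspec
    have hex := mem_span_insert_exchange hspec hnot
    refine firstIndex_eq _ _ _ _ ?_ ?_
    · rw [windowSpan_succ, window_reverse, hback]
      exact hex
    · intro q hq hmem
      have h1 := windowSpan_mono A c⁻¹ ((c ^ (p + 1)) j) (Nat.lt_succ_iff.1 hq) hmem
      rw [windowSpan, window_reverse] at h1
      apply hnot
      rw [windowSpan]
      rwa [Submodule.span_insert_eq_span h1] at hspec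

end Perm

/-- The permutation `π(A) ∈ S_M` of a matrix with columns `v_1, …, v_M`, the column indices being
read cyclically: `π(A)(j)` is the first index `i` in the list `j - 1, j - 2, …, j - M = j` with
`v_j ∈ span(v_{j-1}, v_{j-2}, …, v_i)` (and `π(A)(j) = j` if `v_j = 0`). Its inverse sends `i` to
the first `j` in `i + 1, i + 2, …` with `v_i ∈ span(v_{i+1}, …, v_j)`. For `A` of full rank without
fixed points, the exceedances `i < π(A)(i)` are the pivots of `A`. -/
noncomputable def perm {N M : ℕ} (A : Matrix (Fin N) (Fin M) ℝ) : Equiv.Perm (Fin M) where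
  toFun := firstElement A (finRotate M)⁻¹
  invFun := firstElement A (finRotate M)
  left_inv j := by simpa using firstElement_inv A (finRotate M)⁻¹ j
  right_inv j := firstElement_inv A (finRotate M) j

/-! ### The κ-direct sum -/

/-- The `κ`-direct sum of `A₁` and `A₂`: column `φ (j, k)` carries the `j`-th column of `A_k` in the
rows belonging to `A_k`, and all other entries vanish. The equivalence `ρ` is the assignment of the
row index. -/
def kappaDirectSum {n₁ m₁ n₂ m₂ : ℕ} (A₁ : Matrix (Fin n₁) (Fin m₁) ℝ)
    (A₂ : Matrix (Fin n₂) (Fin m₂) ℝ) (φ : Fin m₁ ⊕ Fin m₂ ≃ Fin (m₁ + m₂))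
    (ρ : Fin n₁ ⊕ Fin n₂ ≃ Fin (n₁ + n₂)) :
    Matrix (Fin (n₁ + n₂)) (Fin (m₁ + m₂)) ℝ :=
  (Matrix.fromBlocks A₁ 0 0 A₂).submatrix ρ.symm φ.symm

/-! ### Exponentials of the τ-function -/

/-- `ξ(t, k) = ∑_{n ≥ 1} k^n t_n`; the time `t_{n+1}` is `t n`. -/
noncomputable def xi (t : ℕ → ℝ) (k : ℝ) : ℝ := ∑' n : ℕ, k ^ (n + 1) * t n

/-- The times `(t_1, t_2, t_3, …) = (x, y, s_0, s_1, …)`. -/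
def times (x y : ℝ) (s : ℕ → ℝ) : ℕ → ℝ
  | 0 => x
  | 1 => y
  | n + 2 => s n

/-- `E_I(t) = ∏_{k > l} (κ_{i_k} - κ_{i_l}) · E_{i_1}(t) ⋯ E_{i_N}(t)` with
`E_j(t) = exp ξ(t, κ_j)`. -/
noncomputable def expo {N M : ℕ} (κ : Fin M → ℝ) (t : ℕ → ℝ) (I : Fin N ↪o Fin M) : ℝ :=
  (∏ k, ∏ l ∈ Finset.Iio k, (κ (I k) - κ (I l))) * ∏ k, Real.exp (xi t (κ (I k)))

/-- The term `Δ_I(A) E_I(t)` of the τ-function `τ(t) = ∑_{I ∈ 𝓜(A)} Δ_I(A) E_I(t)`. -/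
noncomputable def tauTerm {N M : ℕ} (κ : Fin M → ℝ) (A : Matrix (Fin N) (Fin M) ℝ) (t : ℕ → ℝ)
    (I : Fin N ↪o Fin M) : ℝ :=
  minor A I * expo κ t I

/-- `U` is a nonempty open sector (cone with apex `0`) of the `xy`-plane. -/
def IsSector (U : Set (ℝ × ℝ)) : Prop :=
  IsOpen U ∧ U.Nonempty ∧ ∀ p ∈ U, ∀ a : ℝ, 0 < a → a • p ∈ U

/-- The set of dominant exponentials (labelled by `I`) of the solution generated by `(κ, A)`, at
fixed times `(t_3, t_4, …) = s`: those `E_I` occurring in the τ-function for which there is a sector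
of the `xy`-plane in which, as `x² + y² → ∞`, all other terms of the τ-function are negligible
against `Δ_I(A) E_I`. -/
def dominantExponentials {N M : ℕ} (κ : Fin M → ℝ) (A : Matrix (Fin N) (Fin M) ℝ) (s : ℕ → ℝ) :
    Set (Fin N ↪o Fin M) :=
  {I | I ∈ matroid A ∧ ∃ U, IsSector U ∧ ∀ J ∈ matroid A, J ≠ I →
    (fun p : ℝ × ℝ => tauTerm κ A (times p.1 p.2 s) J)
      =o[Bornology.cobounded (ℝ × ℝ) ⊓ 𝓟 U]
    (fun p : ℝ × ℝ => tauTerm κ A (times p.1 p.2 s) I)}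

end KPSoliton

namespace KPSoliton

/-! With the higher times fixed, each term of the τ-function is a nonzero constant times the
exponential of a linear form in `(x, y)`. Hence `E_I` is dominant exactly when, in some direction,
`I` is the unique basis of maximal total weight `∑ (κ_i x + κ_i² y)`
(`mem_dominantExponentials_iff`). The direction can be perturbed until all weights are distinct. The
greedy algorithm then describes the maximal basis: it contains `i` iff column `i` is not spanned by
the columns of larger weight (`mem_range_iff_of_isMax`). So only these span conditions matter.

The weights are values of one quadratic polynomial at increasing points, so the indices heavier than
`i` form a possibly empty cyclic interval `W` ending next to `i` (`weight_lt_cyclic`). For such `W`,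
the definition of `π` says that column `i` lies in the span of `W` iff `π(i)`, or `π⁻¹(i)` on the
other side, lies in `W`. A fixed point would be ambiguous: a zero column and a column outside the
span of all others both give one.

For the direct sum the span conditions decouple into blocks; `φ` preserves cyclic order on each
block, and the product permutation restricts there to `π(A_k)`. Both matrices therefore satisfy the
same conditions (`mem_span_iff_kappaDirectSum_mem_span`) and have the same maximal bases. -/

/-- The growth rate of `E_j` in the direction `p` of the `xy`-plane. -/
noncomputable def weight {M : ℕ} (κ : Fin M → ℝ) (p : ℝ × ℝ) (i : Fin M) : ℝ :=
  κ i * p.1 + κ i ^ 2 * p.2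

/-- The growth rate of `E_I` in the direction `p` of the `xy`-plane. -/
noncomputable def totalWeight {N M : ℕ} (κ : Fin M → ℝ) (p : ℝ × ℝ) (I : Fin N ↪o Fin M) : ℝ :=
  ∑ k, weight κ p (I k)

/-! ### Dominance as a strict maximum of linear forms -/

section Asymptotics

variable {N M : ℕ} (κ : Fin M → ℝ)

theorem xi_times (x y : ℝ) (s : ℕ → ℝ) (k : ℝ) (h : Summable fun n : ℕ => k ^ (n + 3) * s n) :
    xi (times x y s) k = (k * x + k ^ 2 * y) + ∑' n : ℕ, k ^ (n + 3) * s n := by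
  have h' : Summable fun n : ℕ => k ^ (n + 1) * times x y s n :=
    (summable_nat_add_iff 2).1 h
  rw [xi, ← h'.sum_add_tsum_nat_add 2]
  simp [Finset.sum_range_succ, times]

theorem totalWeight_smul (a : ℝ) (p : ℝ × ℝ) (I : Fin N ↪o Fin M) :
    totalWeight κ (a • p) I = a * totalWeight κ p I := by
  simp only [totalWeight, weight, Finset.mul_sum, Prod.smul_fst, Prod.smul_snd, smul_eq_mul]
  exact Finset.sum_congr rfl fun _ _ => by ring

theorem continuous_totalWeight (I : Fin N ↪o Fin M) :
    Continuous fun p : ℝ × ℝ => totalWeight κ p I := by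
  unfold totalWeight weight
  fun_prop

variable {κ}

theorem exists_tauTerm_eq (hκ : StrictMono κ) (A : Matrix (Fin N) (Fin M) ℝ) {s : ℕ → ℝ}
    (hs : ∀ i, Summable fun n : ℕ => κ i ^ (n + 3) * s n) {I : Fin N ↪o Fin M}
    (hI : I ∈ matroid A) :
    ∃ C : ℝ, C ≠ 0 ∧ ∀ p : ℝ × ℝ,
      tauTerm κ A (times p.1 p.2 s) I = C * Real.exp (totalWeight κ p I) := by
  refine ⟨minor A I * ((∏ k, ∏ l ∈ Finset.Iio k, (κ (I k) - κ (I l))) *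
    ∏ k, Real.exp (∑' n : ℕ, κ (I k) ^ (n + 3) * s n)), ?_, fun p => ?_⟩
  · refine mul_ne_zero hI (mul_ne_zero ?_ ?_)
    · refine Finset.prod_ne_zero_iff.2 fun k _ => Finset.prod_ne_zero_iff.2 fun l hl => ?_
      exact (sub_pos.2 (hκ (I.strictMono (Finset.mem_Iio.1 hl)))).ne'
    · exact Finset.prod_ne_zero_iff.2 fun k _ => (Real.exp_pos _).ne'
  · simp only [tauTerm, expo, xi_times _ _ _ _ (hs _), Real.exp_add, Finset.prod_mul_distrib,
      totalWeight, Real.exp_sum, weight]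
    ring

theorem mem_dominantExponentials_iff (hκ : StrictMono κ) (A : Matrix (Fin N) (Fin M) ℝ)
    {s : ℕ → ℝ} (hs : ∀ i, Summable fun n : ℕ => κ i ^ (n + 3) * s n) (I : Fin N ↪o Fin M) :
    I ∈ dominantExponentials κ A s ↔ I ∈ matroid A ∧
      ∃ p, ∀ J ∈ matroid A, J ≠ I → totalWeight κ p J < totalWeight κ p I := by
  refine and_congr_right fun hI => ?_
  obtain ⟨CI, hCI, eqI⟩ := exists_tauTerm_eq hκ A hs hI
  have hCI' := abs_pos.2 hCI
  constructor
  · rintro ⟨U, ⟨hUo, hUn, hUc⟩, hU⟩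
    -- A sector may contain the apex; a nonzero point is needed for its ray to go to infinity.
    obtain ⟨p, hpU, hp0⟩ := (dense_compl_singleton (0 : ℝ × ℝ)).inter_open_nonempty U hUo hUn
    refine ⟨p, fun J hJ hJI => lt_of_not_ge fun hle => ?_⟩
    obtain ⟨CJ, hCJ, eqJ⟩ := exists_tauTerm_eq hκ A hs hJ
    have hCJ' := abs_pos.2 hCJ
    have hray : Tendsto (fun a : ℝ => a • p) atTop (Bornology.cobounded (ℝ × ℝ) ⊓ 𝓟 U) := by
      refine tendsto_inf.2 ⟨?_, tendsto_principal.2 ?_⟩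
      · rw [← tendsto_norm_atTop_iff_cobounded]
        simp only [norm_smul]
        exact tendsto_abs_atTop_atTop.atTop_mul_const (norm_pos_iff.2 hp0)
      · filter_upwards [eventually_gt_atTop 0] with a ha using hUc p hpU a ha
    -- With this constant, negligibility bounds the `J` term by half of `|CJ| exp` of the `I`
    -- weight, which is impossible if the `J` weight is at least as large.
    have hb := ((hU J hJ hJI).comp_tendsto hray).bound
      (show 0 < |CJ| / (2 * |CI|) by positivity)
    obtain ⟨a, ha, ha0⟩ := (hb.and (eventually_gt_atTop 0)).exists
    simp only [Function.comp_apply, eqI, eqJ, totalWeight_smul, norm_mul, Real.norm_eq_abs,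
      Real.abs_exp] at ha
    have h1 : Real.exp (a * totalWeight κ p I) ≤ Real.exp (a * totalWeight κ p J) :=
      Real.exp_le_exp.2 (mul_le_mul_of_nonneg_left hle ha0.le)
    have h2 : |CJ| / (2 * |CI|) * (|CI| * Real.exp (a * totalWeight κ p I)) =
        |CJ| * (Real.exp (a * totalWeight κ p I) / 2) := by field_simp
    rw [h2] at ha
    have h3 := le_of_mul_le_mul_left ha hCJ'
    have h4 := Real.exp_pos (a * totalWeight κ p I)
    linarith
  · rintro ⟨p, hp⟩
    have : Finite (Fin N ↪o Fin M) := DFunLike.finite _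
    have hε : ∀ᶠ ε in 𝓝[>] (0 : ℝ), ∀ J : Fin N ↪o Fin M, J ∈ matroid A → J ≠ I →
        ε * ‖p‖ < totalWeight κ p I - totalWeight κ p J := by
      refine eventually_all.2 fun J => ?_
      by_cases hJ : J ∈ matroid A ∧ J ≠ I
      · have : Tendsto (fun ε : ℝ => ε * ‖p‖) (𝓝[>] 0) (𝓝 (0 * ‖p‖)) :=
          (Continuous.tendsto (by fun_prop) 0).mono_left nhdsWithin_le_nhds
        rw [zero_mul] at this
        filter_upwards [this.eventually_lt_const (sub_pos.2 (hp J hJ.1 hJ.2))] with ε h _ _ using h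
      · exact Eventually.of_forall fun ε h h' => (hJ ⟨h, h'⟩).elim
    obtain ⟨ε, hε, hε0⟩ := (hε.and self_mem_nhdsWithin).exists
    have hε0 : 0 < ε := hε0
    -- This cone keeps every weight gap above `ε‖q‖`, so each quotient of terms decays at least like
    -- `exp (-ε‖q‖)`, uniformly in the cone.
    refine ⟨{q | ∀ J : Fin N ↪o Fin M, J ∈ matroid A → J ≠ I →
        ε * ‖q‖ < totalWeight κ q I - totalWeight κ q J}, ⟨?_, ⟨p, hε⟩, ?_⟩, ?_⟩
    · simp only [Set.ofPred_forall]
      refine isOpen_iInter_of_finite fun J => isOpen_iInter_of_finite fun _ =>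
        isOpen_iInter_of_finite fun _ => ?_
      exact isOpen_lt (by fun_prop)
        ((continuous_totalWeight κ I).sub (continuous_totalWeight κ J))
    · intro q hq a ha J hJ hJI
      have := mul_lt_mul_of_pos_left (hq J hJ hJI) ha
      rw [totalWeight_smul, totalWeight_smul, norm_smul, Real.norm_of_nonneg ha.le]
      linarith
    · intro J hJ hJI
      obtain ⟨CJ, hCJ, eqJ⟩ := exists_tauTerm_eq hκ A hs hJ
      have hCJ' := abs_pos.2 hCJ
      refine Asymptotics.IsLittleO.of_bound fun c hc => ?_
      have hlim : Tendsto (fun q : ℝ × ℝ => |CJ| * Real.exp (-(ε * ‖q‖)))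
          (Bornology.cobounded (ℝ × ℝ)) (𝓝 (|CJ| * 0)) :=
        (Real.tendsto_exp_neg_atTop_nhds_zero.comp
          (tendsto_norm_cobounded_atTop.const_mul_atTop hε0)).const_mul _
      rw [mul_zero] at hlim
      have hev := hlim.eventually_lt_const (mul_pos hc hCI')
      rw [eventually_inf_principal]
      filter_upwards [hev] with q hq hqU
      have hgap := hqU J hJ hJI
      simp only [eqI, eqJ, norm_mul, Real.norm_eq_abs, Real.abs_exp]
      calc |CJ| * Real.exp (totalWeight κ q J)
          ≤ |CJ| * (Real.exp (-(ε * ‖q‖)) * Real.exp (totalWeight κ q I)) := by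
            rw [← Real.exp_add]
            gcongr
            linarith
        _ = |CJ| * Real.exp (-(ε * ‖q‖)) * Real.exp (totalWeight κ q I) := by ring
        _ ≤ c * |CI| * Real.exp (totalWeight κ q I) := by gcongr
        _ = c * (|CI| * Real.exp (totalWeight κ q I)) := by ring

/-- A strict maximum persists at a direction in which all `E_j` grow at different rates. -/
theorem exists_injective_weight (hκ : StrictMono κ) {S : Set (Fin N ↪o Fin M)}
    {I : Fin N ↪o Fin M} {p : ℝ × ℝ}
    (hp : ∀ J ∈ S, J ≠ I → totalWeight κ p J < totalWeight κ p I) :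
    ∃ q, Function.Injective (weight κ q) ∧
      ∀ J ∈ S, J ≠ I → totalWeight κ q J < totalWeight κ q I := by
  have : Finite (Fin N ↪o Fin M) := DFunLike.finite _
  have hcont : Tendsto (fun ε : ℝ => p + ε • ((1, 0) : ℝ × ℝ)) (𝓝[>] 0) (𝓝 p) := by
    have : Tendsto (fun ε : ℝ => p + ε • ((1, 0) : ℝ × ℝ)) (𝓝[>] 0)
        (𝓝 (p + (0 : ℝ) • ((1, 0) : ℝ × ℝ))) :=
      (Continuous.tendsto (by fun_prop) 0).mono_left nhdsWithin_le_nhds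
    simpa using this
  have h1 : ∀ᶠ ε in 𝓝[>] (0 : ℝ), ∀ J : Fin N ↪o Fin M, J ∈ S → J ≠ I →
      totalWeight κ (p + ε • ((1, 0) : ℝ × ℝ)) J <
        totalWeight κ (p + ε • ((1, 0) : ℝ × ℝ)) I := by
    refine eventually_all.2 fun J => ?_
    by_cases hJ : J ∈ S ∧ J ≠ I
    · filter_upwards [(((continuous_totalWeight κ J).tendsto p).comp hcont).eventually_lt
        (((continuous_totalWeight κ I).tendsto p).comp hcont) (hp J hJ.1 hJ.2)] with ε h _ _ using h
    · exact Eventually.of_forall fun ε h h' => (hJ ⟨h, h'⟩).elim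
  have h2 : ∀ᶠ ε in 𝓝[>] (0 : ℝ), ∀ i j : Fin M, i ≠ j →
      weight κ (p + ε • ((1, 0) : ℝ × ℝ)) i ≠ weight κ (p + ε • ((1, 0) : ℝ × ℝ)) j := by
    refine eventually_all.2 fun i => eventually_all.2 fun j => ?_
    by_cases hij : i = j
    · exact Eventually.of_forall fun _ h => (h hij).elim
    have hne : κ i - κ j ≠ 0 := sub_ne_zero.2 (hκ.injective.ne hij)
    -- Since `κ i ≠ κ j`, the weights of `i` and `j` along the perturbation coincide for only one
    -- `ε`.
    have hfin : ∀ᶠ ε in 𝓝[>] (0 : ℝ), ε ≠ (weight κ p j - weight κ p i) / (κ i - κ j) := by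
      rcases le_or_gt ((weight κ p j - weight κ p i) / (κ i - κ j)) 0 with h | h
      · filter_upwards [self_mem_nhdsWithin] with ε hε using (h.trans_lt hε).ne'
      · filter_upwards [Ioo_mem_nhdsGT h] with ε hε using hε.2.ne
    filter_upwards [hfin] with ε hε _ heq
    apply hε
    rw [eq_div_iff hne]
    simp only [weight, Prod.fst_add, Prod.snd_add, Prod.smul_fst, Prod.smul_snd, smul_eq_mul,
      mul_one, mul_zero, add_zero] at heq ⊢
    linarith
  obtain ⟨ε, hε1, hε2⟩ := (h1.and h2).exists
  exact ⟨_, fun i j h => by_contra fun hij => hε2 i j hij h, hε1⟩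

end Asymptotics

/-! ### Maximal-weight bases and the greedy algorithm -/

section Greedy

/-- The greedy algorithm: a linearly independent family of maximal size and of maximal total
weight consists of the vectors that are not spanned by those of larger weight. -/
theorem mem_iff_notMem_span_of_isMax {ι V : Type*} [Fintype ι] [AddCommGroup V] [Module ℝ V]
    (v : ι → V) {w : ι → ℝ} (hw : Function.Injective w) {s : Finset ι}
    (hs : LinearIndepOn ℝ v (s : Set ι)) (htop : Submodule.span ℝ (v '' (s : Set ι)) = ⊤)
    (hmax : ∀ t : Finset ι, LinearIndepOn ℝ v (t : Set ι) → t.card = s.card →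
      ∑ i ∈ t, w i ≤ ∑ i ∈ s, w i) (i : ι) :
    i ∈ s ↔ v i ∉ Submodule.span ℝ (v '' {j | w i < w j}) := by
  classical
  -- Replacing `a` by such a `b` gives another independent family of the same size, so it cannot
  -- increase the weight.
  have exchange : ∀ a ∈ s, ∀ b, v b ∉ Submodule.span ℝ (v '' ((s.erase a : Finset ι) : Set ι)) →
      w b ≤ w a := by
    intro a ha b hb
    have hbn : b ∉ s.erase a := fun h => hb (Submodule.subset_span ⟨b, h, rfl⟩)
    have hind : LinearIndepOn ℝ v ((insert b (s.erase a) : Finset ι) : Set ι) := by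
      rw [Finset.coe_insert]
      exact (hs.mono (Finset.coe_subset.2 (Finset.erase_subset _ _))).insert hb
    have h := hmax _ hind (by
      rw [Finset.card_insert_of_notMem hbn, Finset.card_erase_add_one ha])
    rw [Finset.sum_insert hbn, ← Finset.add_sum_erase s w ha] at h
    linarith
  have hnot : ∀ a ∈ s, v a ∉ Submodule.span ℝ (v '' ((s.erase a : Finset ι) : Set ι)) := by
    intro a ha
    rw [Finset.coe_erase]
    exact hs.notMem_span ha
  constructor
  · intro hi hspan
    -- The span of `s` without `i` misses `v i`, so it cannot contain all heavier vectors.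
    have : ∃ j, w i < w j ∧ v j ∉ Submodule.span ℝ (v '' ((s.erase i : Finset ι) : Set ι)) := by
      by_contra! hcon
      refine hnot i hi (Submodule.span_le.2 ?_ hspan)
      rintro _ ⟨j, hj, rfl⟩
      exact hcon j hj
    obtain ⟨j, hj, hj'⟩ := this
    exact (exchange i hi j hj').not_gt hj
  · intro hi
    by_contra his
    have hmem : v i ∈ Submodule.span ℝ (v '' (s : Set ι)) := htop ▸ Submodule.mem_top
    obtain ⟨c, hc⟩ := (Submodule.mem_span_image_finset_iff_exists_fun' ℝ).1 hmem
    apply hi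
    rw [← hc]
    refine Submodule.sum_mem _ fun j hj => ?_
    by_cases hcj : c j = 0
    · simp [hcj]
    refine Submodule.smul_mem _ _ (Submodule.subset_span ⟨j, ?_, rfl⟩)
    -- As `j` occurs in the expansion of `v i` with nonzero coefficient, `i` can replace `j`:
    -- otherwise `v j` would lie in the span of the others.
    have hle : w i ≤ w j := by
      refine exchange j hj i fun hin => hnot j hj ?_
      have hsum : ∑ k ∈ s.erase j, c k • v k ∈
          Submodule.span ℝ (v '' ((s.erase j : Finset ι) : Set ι)) :=
        Submodule.sum_mem _ fun k hk => Submodule.smul_mem _ _ (Submodule.subset_span ⟨k, hk, rfl⟩)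
      have heq : c j • v j = v i - ∑ k ∈ s.erase j, c k • v k := by
        rw [← hc, ← Finset.add_sum_erase s _ hj, add_sub_cancel_right]
      have := Submodule.smul_mem _ (c j)⁻¹ (heq ▸ Submodule.sub_mem _ hin hsum)
      rwa [inv_smul_smul₀ hcj] at this
    exact lt_of_le_of_ne hle fun h => his (hw h ▸ hj)

variable {N M : ℕ} {A : Matrix (Fin N) (Fin M) ℝ}

theorem mem_matroid_iff {I : Fin N ↪o Fin M} :
    I ∈ matroid A ↔ LinearIndepOn ℝ A.col (Set.range I) := by
  rw [linearIndepOn_range_iff I.injective]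
  change (A.submatrix id I).det ≠ 0 ↔ LinearIndependent ℝ (A.submatrix id I).col
  rw [Matrix.linearIndependent_cols_iff_isUnit, Matrix.isUnit_iff_isUnit_det, isUnit_iff_ne_zero]

theorem totalWeight_eq_sum_map (κ : Fin M → ℝ) (p : ℝ × ℝ) (I : Fin N ↪o Fin M) :
    totalWeight κ p I = ∑ i ∈ Finset.univ.map I.toEmbedding, weight κ p i := by
  simp [totalWeight]

theorem mem_range_iff_of_isMax {κ : Fin M → ℝ} {p : ℝ × ℝ}
    (hw : Function.Injective (weight κ p)) {I : Fin N ↪o Fin M} (hI : I ∈ matroid A)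
    (hmax : ∀ J ∈ matroid A, totalWeight κ p J ≤ totalWeight κ p I) (i : Fin M) :
    i ∈ Set.range I ↔
      A.col i ∉ Submodule.span ℝ (A.col '' {j | weight κ p i < weight κ p j}) := by
  have hcoe : ((Finset.univ.map I.toEmbedding : Finset (Fin M)) : Set (Fin M)) = Set.range I := by
    simp
  have hI' := mem_matroid_iff.1 hI
  have key := mem_iff_notMem_span_of_isMax A.col hw
    (s := Finset.univ.map I.toEmbedding) (by rwa [hcoe]) ?_ ?_ i
  · rw [← key, ← hcoe, Finset.mem_coe]
  · rw [hcoe, ← Set.range_comp]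
    exact ((linearIndepOn_range_iff I.injective _).1 hI').span_eq_top_of_card_eq_finrank' (by simp)
  · intro t ht htc
    have htN : t.card = N := by simpa using htc
    have hmap : Finset.univ.map (t.orderEmbOfFin htN).toEmbedding = t := by simp
    have := hmax (t.orderEmbOfFin htN) (mem_matroid_iff.2 (by simpa using ht))
    rwa [totalWeight_eq_sum_map, totalWeight_eq_sum_map, hmap] at this

theorem matroid_nonempty (h : Submodule.span ℝ (Set.range A.col) = ⊤) :
    (matroid A).Nonempty := by
  obtain ⟨b, -, -, hspan, hli⟩ := exists_linearIndepOn_extension (K := ℝ) (v := A.col)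
    (linearIndepOn_empty _ _) (Set.subset_univ ∅)
  have htop : Submodule.span ℝ (A.col '' b) = ⊤ := by
    rw [eq_top_iff, ← h, ← Set.image_univ]
    exact Submodule.span_le.2 hspan
  lift b to Finset (Fin M) using b.toFinite
  have hcard : b.card = N := by
    have hspan_card := finrank_span_eq_card hli
    rw [show Set.range (fun x : (b : Set (Fin M)) => A.col x) = A.col '' b by
      rw [Set.image_eq_range], htop, finrank_top, Module.finrank_fin_fun] at hspan_card
    simpa using hspan_card.symm
  exact ⟨b.orderEmbOfFin hcard, mem_matroid_iff.2 (by simpa using hli)⟩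

end Greedy

/-! ### Cyclic intervals and the permutation of a matrix -/

section Window

/-- The elements `a`, `b`, `c` are met in this order when running cyclically upwards from `a`. -/
def CyclicLT {α : Type*} [LT α] (a b c : α) : Prop :=
  a < b ∧ b < c ∨ b < c ∧ c < a ∨ c < a ∧ a < b

theorem cyclicLT_iff_of_strictMono {α β : Type*} [LinearOrder α] [Preorder β] {f : α → β}
    (hf : StrictMono f) {a b c : α} : CyclicLT (f a) (f b) (f c) ↔ CyclicLT a b c := by
  simp only [CyclicLT, hf.lt_iff_lt]

/-- `W` consists of the first few elements of `c i, c² i, …`, stopping before `i`. -/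
def IsWindow {ι : Type*} (c : Equiv.Perm ι) (i : ι) (W : Set ι) : Prop :=
  i ∉ W ∧ ∀ k, (∀ r ≤ k, (c ^ (r + 1)) i ≠ i) → (c ^ (k + 1)) i ∈ W → ∀ r < k, (c ^ (r + 1)) i ∈ W

/-- Initial segments of the orbit are nested, so the span of `W` contains column `i` iff `W`
includes the shortest segment that spans it. The last element of that segment is `firstElement A c
i`. -/
theorem mem_span_iff_firstElement_mem {ι : Type*} [Finite ι] {N : ℕ} (A : Matrix (Fin N) ι ℝ)
    (c : Equiv.Perm ι) {i : ι} (hc : ∀ j, ∃ k, (c ^ (k + 1)) i = j) {W : Set ι}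
    (hW : IsWindow c i W) (hne : firstElement A c i ≠ i) :
    A.col i ∈ Submodule.span ℝ (A.col '' W) ↔ firstElement A c i ∈ W := by
  classical
  have hspec : A.col i ∈ windowSpan A c i (firstIndex A c i) := firstIndex_spec A c i
  have hmin : ∀ p < firstIndex A c i, A.col i ∉ windowSpan A c i p := fun p hp =>
    Nat.find_min (exists_mem_windowSpan A c i) hp
  unfold firstElement at hne ⊢
  generalize firstIndex A c i = f at hspec hmin hne ⊢
  obtain _ | f := f
  · simp at hne
  constructor
  · intro hspan
    by_contra hf
    apply hmin f (Nat.lt_succ_self f)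
    refine Submodule.span_mono ?_ hspan
    rintro _ ⟨j, hj, rfl⟩
    -- With the least number of steps from `i` to `j`, the orbit does not pass through `i` on the
    -- way; restarting at `i` would be shorter.
    have hr := Nat.find_spec (hc j)
    have hrmin : ∀ q < Nat.find (hc j), (c ^ (q + 1)) i ≠ j := fun q hq => Nat.find_min (hc j) hq
    generalize Nat.find (hc j) = r at hr hrmin
    have hret : ∀ q ≤ r, (c ^ (q + 1)) i ≠ i := by
      intro q hq hqi
      rcases hq.eq_or_lt with rfl | hq
      · exact hW.1 (hqi ▸ hr ▸ hj)
      · refine hrmin (r - q - 1) (by omega) ?_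
        rw [← hr]
        nth_rw 1 [← hqi]
        rw [← Equiv.Perm.mul_apply, ← pow_add]
        congr 2
        omega
    subst hr
    refine ⟨r, ?_, rfl⟩
    by_contra hrf
    rcases (not_lt.1 (Set.mem_Iio.not.1 hrf)).eq_or_lt with h | h
    · exact hf (h ▸ hj)
    · exact hf (hW.2 r hret hj f h)
  · intro hf
    have hret : ∀ q ≤ f, (c ^ (q + 1)) i ≠ i := by
      intro q hq hqi
      rcases hq.eq_or_lt with rfl | hq
      · exact hne hqi
      -- An earlier return to `i` would put column `i` itself into a shorter window.
      · refine hmin (q + 1) (by omega) (Submodule.subset_span ⟨q, Nat.lt_succ_self q, ?_⟩)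
        change A.col ((c ^ (q + 1)) i) = A.col i
        rw [hqi]
    refine Submodule.span_mono ?_ hspec
    rintro _ ⟨r, hr, rfl⟩
    refine ⟨(c ^ (r + 1)) i, ?_, rfl⟩
    rcases (Nat.lt_succ_iff.1 hr).eq_or_lt with rfl | hr
    · exact hf
    · exact hW.2 f hret hf r hr

variable {n : ℕ}

theorem val_finRotate_pow (i : Fin n) (k : ℕ) :
    (((finRotate n) ^ k) i).val = (i.val + k) % n := by
  have := i.neZero
  induction k with
  | zero => simp [Nat.mod_eq_of_lt i.2]
  | succ k ih =>
    rw [pow_succ', Equiv.Perm.mul_apply, finRotate_apply, Fin.val_add, ih, Fin.coe_ofNat_eq_mod,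
      ← Nat.add_mod, add_assoc]

theorem exists_finRotate_pow (i j : Fin n) : ∃ k, ((finRotate n) ^ (k + 1)) i = j := by
  refine ⟨n + j - i - 1, Fin.ext ?_⟩
  rw [val_finRotate_pow, show i.val + (n + j - i - 1 + 1) = j + n by omega, Nat.add_mod_right,
    Nat.mod_eq_of_lt j.2]

theorem exists_finRotate_inv_pow (i j : Fin n) : ∃ k, ((finRotate n)⁻¹ ^ (k + 1)) i = j := by
  obtain ⟨k, hk⟩ := exists_finRotate_pow j i
  exact ⟨k, by rw [inv_pow, Equiv.Perm.inv_eq_iff_eq, hk]⟩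

theorem cyclicLT_finRotate_pow (i : Fin n) {a b : ℕ} (ha : 0 < a) (hab : a < b) (hb : b < n) :
    CyclicLT i (((finRotate n) ^ a) i) (((finRotate n) ^ b) i) := by
  have mod_eq : ∀ k < n, (i.val + k) % n = if i.val + k < n then i.val + k else i.val + k - n := by
    intro k hk
    split_ifs with h
    · exact Nat.mod_eq_of_lt h
    · rw [Nat.mod_eq_sub_mod (by omega), Nat.mod_eq_of_lt (by omega)]
  simp only [CyclicLT, Fin.lt_def, val_finRotate_pow, mod_eq a (by omega), mod_eq b hb]
  split_ifs <;> omega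

theorem finRotate_pow_self : (finRotate n) ^ n = 1 := by
  ext i
  rw [val_finRotate_pow, Nat.add_mod_right, Nat.mod_eq_of_lt i.2, Equiv.Perm.one_apply]

theorem isWindow_finRotate {i : Fin n} {W : Set (Fin n)} (hi : i ∉ W)
    (hW : ∀ j ∈ W, ∀ j', CyclicLT i j' j → j' ∈ W) : IsWindow (finRotate n) i W := by
  refine ⟨hi, fun k hret hk r hr => ?_⟩
  have hkn : k + 1 < n := by
    by_contra! h
    apply hret (n - 1) (by omega)
    rw [Nat.sub_add_cancel i.pos, finRotate_pow_self, Equiv.Perm.one_apply]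
  exact hW _ hk _ (cyclicLT_finRotate_pow i (by omega) (by omega) hkn)

theorem isWindow_finRotate_inv {i : Fin n} {W : Set (Fin n)} (hi : i ∉ W)
    (hW : ∀ j ∈ W, ∀ j', CyclicLT j j' i → j' ∈ W) : IsWindow (finRotate n)⁻¹ i W := by
  refine ⟨hi, fun k hret hk r hr => ?_⟩
  have hkn : k + 1 < n := by
    by_contra! h
    apply hret (n - 1) (by omega)
    rw [Nat.sub_add_cancel i.pos, inv_pow, finRotate_pow_self, inv_one, Equiv.Perm.one_apply]
  refine hW _ hk _ ?_
  -- The backward orbit of `i` is read as the forward orbit of its endpoint, which reaches `i` after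
  -- `k + 1` steps.
  have h := cyclicLT_finRotate_pow (((finRotate n)⁻¹ ^ (k + 1)) i) (a := k - r) (b := k + 1)
    (by omega) (by omega) hkn
  have h1 : (finRotate n) ^ (k - r) * (finRotate n)⁻¹ ^ (k + 1) = (finRotate n)⁻¹ ^ (r + 1) := by
    rw [show k + 1 = k - r + (r + 1) by omega, pow_add, inv_pow, mul_inv_cancel_left]
  have h2 : (finRotate n) ^ (k + 1) * (finRotate n)⁻¹ ^ (k + 1) = 1 := by
    rw [inv_pow, mul_inv_cancel]
  rwa [← Equiv.Perm.mul_apply, ← Equiv.Perm.mul_apply, h1, h2, Equiv.Perm.one_apply] at h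

variable {N : ℕ} {A : Matrix (Fin N) (Fin n) ℝ} {i : Fin n} {W : Set (Fin n)}

theorem mem_span_iff_perm_symm_mem (hd : perm A ∈ derangements (Fin n)) (hi : i ∉ W)
    (hW : ∀ j ∈ W, ∀ j', CyclicLT i j' j → j' ∈ W) :
    A.col i ∈ Submodule.span ℝ (A.col '' W) ↔ (perm A).symm i ∈ W :=
  mem_span_iff_firstElement_mem A _ (exists_finRotate_pow i) (isWindow_finRotate hi hW)
    fun h => hd i ((perm A).symm_apply_eq.1 h).symm

theorem mem_span_iff_perm_mem (hd : perm A ∈ derangements (Fin n)) (hi : i ∉ W)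
    (hW : ∀ j ∈ W, ∀ j', CyclicLT j j' i → j' ∈ W) :
    A.col i ∈ Submodule.span ℝ (A.col '' W) ↔ perm A i ∈ W :=
  mem_span_iff_firstElement_mem A _ (exists_finRotate_inv_pow i) (isWindow_finRotate_inv hi hW)
    (hd i)

/-- A quadratic vanishing at `0` with slope `b ≥ 0` there is positive on a cyclic interval of the
line that begins immediately to the right of `0`, if at all: for `y > 0` it may wrap around through
infinity. -/
theorem CyclicLT.quadratic_pos {b y d e : ℝ} (hb : 0 ≤ b) (hd : 0 < d * (b + y * d))
    (h : CyclicLT 0 e d) : 0 < e * (b + y * e) := by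
  rcases h with ⟨he, hed⟩ | ⟨hed, hd0⟩ | ⟨hd0, he⟩
  · have hd0 := he.trans hed
    have h1 : 0 < b + y * d := pos_of_mul_pos_right hd hd0.le
    have h2 : 0 < d * (b + y * e) := by nlinarith
    exact mul_pos he (pos_of_mul_pos_right h2 hd0.le)
  · have h1 : b + y * d < 0 := neg_of_mul_pos_right hd hd0.le
    have hy : 0 < y := by
      by_contra! hy
      nlinarith
    exact mul_pos_of_neg_of_neg (hed.trans hd0) (by nlinarith)
  · have h1 : b + y * d < 0 := neg_of_mul_pos_right hd hd0.le
    have hy : 0 < y := by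
      by_contra! hy
      nlinarith
    positivity

/-- The weights are values of a quadratic polynomial at increasing points, so that the indices
of larger weight than `i` form a cyclic interval ending next to `i`. -/
theorem weight_lt_cyclic {M : ℕ} {κ : Fin M → ℝ} (hκ : StrictMono κ) (p : ℝ × ℝ) (i : Fin M) :
    (∀ j ∈ {j | weight κ p i < weight κ p j}, ∀ j', CyclicLT i j' j →
      j' ∈ {j | weight κ p i < weight κ p j}) ∨
    (∀ j ∈ {j | weight κ p i < weight κ p j}, ∀ j', CyclicLT j j' i →
      j' ∈ {j | weight κ p i < weight κ p j}) := by
  have hfac : ∀ j, weight κ p i < weight κ p j ↔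
      0 < (κ j - κ i) * ((p.1 + 2 * κ i * p.2) + p.2 * (κ j - κ i)) := by
    intro j
    rw [← sub_pos, weight, weight]
    ring_nf
  simp only [Set.mem_ofPred_eq, hfac, ← cyclicLT_iff_of_strictMono hκ]
  -- Here `b` is the slope of the quadratic at `κ i`; its sign decides on which side of `i` the
  -- heavier indices begin.
  generalize p.1 + 2 * κ i * p.2 = b
  generalize p.2 = y
  rcases le_total 0 b with hb | hb
  · left
    intro j hj j' h
    refine CyclicLT.quadratic_pos hb hj ?_
    rcases h with h | h | h
    · exact Or.inl (by constructor <;> linarith)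
    · exact Or.inr (Or.inl (by constructor <;> linarith))
    · exact Or.inr (Or.inr (by constructor <;> linarith))
  · right
    intro j hj j' h
    -- Reflection in `κ i` reverses the cyclic order and makes the slope nonnegative.
    have key := CyclicLT.quadratic_pos (b := -b) (y := y) (d := κ i - κ j) (e := κ i - κ j')
      (by linarith) (by linarith) ?_
    · linarith
    rcases h with h | h | h
    · exact Or.inl (by constructor <;> linarith)
    · exact Or.inr (Or.inr (by constructor <;> linarith))
    · exact Or.inr (Or.inl (by constructor <;> linarith))

end Window

/-! ### Span conditions in the κ-direct sum -/

section DirectSum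

theorem span_range_col_eq_top {N M : ℕ} {A : Matrix (Fin N) (Fin M) ℝ} (h : A.rank = N) :
    Submodule.span ℝ (Set.range A.col) = ⊤ := by
  apply Submodule.eq_top_of_finrank_eq
  rw [← Matrix.rank_eq_finrank_span_cols, h, Module.finrank_fin_fun]

/-- The retraction `P` kills the vectors of the other block and recovers those of this one, so it
pushes a span relation down; `L` lifts one back. -/
theorem mem_span_image_iff_of_splitting {ι ι' V V' : Type*} [AddCommGroup V] [Module ℝ V]
    [AddCommGroup V'] [Module ℝ V'] {L : V →ₗ[ℝ] V'} {P : V' →ₗ[ℝ] V} (hPL : ∀ x, P (L x) = x)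
    {v : ι → V} {u : ι' → V'} {g : ι → ι'} (hu : ∀ j, u (g j) = L (v j))
    (hz : ∀ k, k ∉ Set.range g → P (u k) = 0) (j : ι) (W : Set ι') :
    u (g j) ∈ Submodule.span ℝ (u '' W) ↔ v j ∈ Submodule.span ℝ (v '' (g ⁻¹' W)) := by
  constructor
  · intro h
    have h' := Submodule.mem_map_of_mem (f := P) h
    rw [hu, hPL, Submodule.map_span] at h'
    refine Submodule.span_le.2 ?_ h'
    rintro _ ⟨_, ⟨k, hk, rfl⟩, rfl⟩
    by_cases hkg : k ∈ Set.range g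
    · obtain ⟨j', rfl⟩ := hkg
      rw [hu, hPL]
      exact Submodule.subset_span ⟨j', hk, rfl⟩
    · rw [hz k hkg]
      exact Submodule.zero_mem _
  · intro h
    have h' := Submodule.mem_map_of_mem (f := L) h
    rw [← hu, Submodule.map_span] at h'
    refine Submodule.span_mono ?_ h'
    rintro _ ⟨_, ⟨j', hj', rfl⟩, rfl⟩
    exact ⟨g j', hj', hu j'⟩

variable {n₁ m₁ n₂ m₂ : ℕ} (A₁ : Matrix (Fin n₁) (Fin m₁) ℝ) (A₂ : Matrix (Fin n₂) (Fin m₂) ℝ)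
  (φ : Fin m₁ ⊕ Fin m₂ ≃ Fin (m₁ + m₂)) (ρ : Fin n₁ ⊕ Fin n₂ ≃ Fin (n₁ + n₂))

/-- The inclusion of the rows of the first summand. -/
def rowsInl : (Fin n₁ → ℝ) →ₗ[ℝ] (Fin (n₁ + n₂) → ℝ) where
  toFun v a := Sum.elim v 0 (ρ.symm a)
  map_add' v w := by ext a; rcases h : ρ.symm a <;> simp [h]
  map_smul' r v := by ext a; rcases h : ρ.symm a <;> simp [h]

/-- The inclusion of the rows of the second summand. -/
def rowsInr : (Fin n₂ → ℝ) →ₗ[ℝ] (Fin (n₁ + n₂) → ℝ) where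
  toFun v a := Sum.elim 0 v (ρ.symm a)
  map_add' v w := by ext a; rcases h : ρ.symm a <;> simp [h]
  map_smul' r v := by ext a; rcases h : ρ.symm a <;> simp [h]

theorem kappaDirectSum_col_inl (j : Fin m₁) :
    (kappaDirectSum A₁ A₂ φ ρ).col (φ (Sum.inl j)) = rowsInl ρ (A₁.col j) := by
  ext a
  rcases h : ρ.symm a <;> simp [kappaDirectSum, rowsInl, h]

theorem kappaDirectSum_col_inr (j : Fin m₂) :
    (kappaDirectSum A₁ A₂ φ ρ).col (φ (Sum.inr j)) = rowsInr ρ (A₂.col j) := by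
  ext a
  rcases h : ρ.symm a <;> simp [kappaDirectSum, rowsInr, h]

theorem kappaDirectSum_mem_span_inl_iff (j : Fin m₁) (W : Set (Fin (m₁ + m₂))) :
    (kappaDirectSum A₁ A₂ φ ρ).col (φ (Sum.inl j)) ∈
      Submodule.span ℝ ((kappaDirectSum A₁ A₂ φ ρ).col '' W) ↔
    A₁.col j ∈ Submodule.span ℝ (A₁.col '' ((φ ∘ Sum.inl) ⁻¹' W)) := by
  refine mem_span_image_iff_of_splitting (L := rowsInl ρ)
    (P := LinearMap.funLeft ℝ ℝ (ρ ∘ Sum.inl)) ?_ (g := φ ∘ Sum.inl)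
    (kappaDirectSum_col_inl A₁ A₂ φ ρ) ?_ j W
  · intro x
    ext a
    simp [rowsInl, LinearMap.funLeft_apply]
  · intro k hk
    obtain ⟨k | k, rfl⟩ := φ.surjective k
    · exact (hk ⟨k, rfl⟩).elim
    · ext a
      simp [kappaDirectSum_col_inr, rowsInr, LinearMap.funLeft_apply]

theorem kappaDirectSum_mem_span_inr_iff (j : Fin m₂) (W : Set (Fin (m₁ + m₂))) :
    (kappaDirectSum A₁ A₂ φ ρ).col (φ (Sum.inr j)) ∈
      Submodule.span ℝ ((kappaDirectSum A₁ A₂ φ ρ).col '' W) ↔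
    A₂.col j ∈ Submodule.span ℝ (A₂.col '' ((φ ∘ Sum.inr) ⁻¹' W)) := by
  refine mem_span_image_iff_of_splitting (L := rowsInr ρ)
    (P := LinearMap.funLeft ℝ ℝ (ρ ∘ Sum.inr)) ?_ (g := φ ∘ Sum.inr)
    (kappaDirectSum_col_inr A₁ A₂ φ ρ) ?_ j W
  · intro x
    ext a
    simp [rowsInr, LinearMap.funLeft_apply]
  · intro k hk
    obtain ⟨k | k, rfl⟩ := φ.surjective k
    · ext a
      simp [kappaDirectSum_col_inl, rowsInl, LinearMap.funLeft_apply]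
    · exact (hk ⟨k, rfl⟩).elim

variable {A₁ A₂}

theorem kappaDirectSum_span_range_col_eq_top (h₁ : Submodule.span ℝ (Set.range A₁.col) = ⊤)
    (h₂ : Submodule.span ℝ (Set.range A₂.col) = ⊤) :
    Submodule.span ℝ (Set.range (kappaDirectSum A₁ A₂ φ ρ).col) = ⊤ := by
  refine eq_top_iff.2 fun x _ => ?_
  have hx : x = rowsInl ρ (fun a => x (ρ (Sum.inl a))) + rowsInr ρ (fun a => x (ρ (Sum.inr a))) := by
    ext a
    obtain ⟨a | a, rfl⟩ := ρ.surjective a <;> simp [rowsInl, rowsInr]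
  rw [hx]
  refine Submodule.add_mem _ ?_ ?_
  · have h := Submodule.mem_map_of_mem (f := rowsInl ρ) (h₁ ▸ Submodule.mem_top :
      (fun a => x (ρ (Sum.inl a))) ∈ Submodule.span ℝ (Set.range A₁.col))
    rw [Submodule.map_span] at h
    refine Submodule.span_mono ?_ h
    rintro _ ⟨_, ⟨j, rfl⟩, rfl⟩
    exact ⟨_, kappaDirectSum_col_inl A₁ A₂ φ ρ j⟩
  · have h := Submodule.mem_map_of_mem (f := rowsInr ρ) (h₂ ▸ Submodule.mem_top :
      (fun a => x (ρ (Sum.inr a))) ∈ Submodule.span ℝ (Set.range A₂.col))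
    rw [Submodule.map_span] at h
    refine Submodule.span_mono ?_ h
    rintro _ ⟨_, ⟨j, rfl⟩, rfl⟩
    exact ⟨_, kappaDirectSum_col_inr A₁ A₂ φ ρ j⟩

variable {φ} {A : Matrix (Fin (n₁ + n₂)) (Fin (m₁ + m₂)) ℝ}

/-- Both sides reduce to the same membership of `π(i)` or `π⁻¹(i)` in `W`. On the right this uses
that the preimage of `W` in the block of `i` is again a cyclic interval next to `i`, as the block
embeds in increasing order. -/
theorem mem_span_iff_kappaDirectSum_mem_span (hφ₁ : StrictMono (φ ∘ Sum.inl))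
    (hφ₂ : StrictMono (φ ∘ Sum.inr)) (hd₁ : perm A₁ ∈ derangements (Fin m₁))
    (hd₂ : perm A₂ ∈ derangements (Fin m₂))
    (hπ : perm A = φ.permCongr (Equiv.Perm.sumCongr (perm A₁) (perm A₂)))
    {i : Fin (m₁ + m₂)} {W : Set (Fin (m₁ + m₂))} (hi : i ∉ W)
    (hW : (∀ j ∈ W, ∀ j', CyclicLT i j' j → j' ∈ W) ∨ (∀ j ∈ W, ∀ j', CyclicLT j j' i → j' ∈ W)) :
    A.col i ∈ Submodule.span ℝ (A.col '' W) ↔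
      (kappaDirectSum A₁ A₂ φ ρ).col i ∈
        Submodule.span ℝ ((kappaDirectSum A₁ A₂ φ ρ).col '' W) := by
  have hl : ∀ j, perm A (φ (Sum.inl j)) = φ (Sum.inl (perm A₁ j)) := by simp [hπ]
  have hr : ∀ j, perm A (φ (Sum.inr j)) = φ (Sum.inr (perm A₂ j)) := by simp [hπ]
  have hl' : ∀ j, (perm A).symm (φ (Sum.inl j)) = φ (Sum.inl ((perm A₁).symm j)) := fun j => by
    rw [Equiv.symm_apply_eq, hl, Equiv.apply_symm_apply]
  have hr' : ∀ j, (perm A).symm (φ (Sum.inr j)) = φ (Sum.inr ((perm A₂).symm j)) := fun j => by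
    rw [Equiv.symm_apply_eq, hr, Equiv.apply_symm_apply]
  have hd : perm A ∈ derangements (Fin (m₁ + m₂)) := by
    intro k hk
    obtain ⟨k | k, rfl⟩ := φ.surjective k
    · rw [hl] at hk
      exact hd₁ k (Sum.inl_injective (φ.injective hk))
    · rw [hr] at hk
      exact hd₂ k (Sum.inr_injective (φ.injective hk))
  obtain ⟨j | j, rfl⟩ := φ.surjective i
  · rw [kappaDirectSum_mem_span_inl_iff]
    rcases hW with hW | hW
    · rw [mem_span_iff_perm_symm_mem hd hi hW, mem_span_iff_perm_symm_mem hd₁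
        (W := (φ ∘ Sum.inl) ⁻¹' W) hi fun a ha b hb => hW _ ha _ ((cyclicLT_iff_of_strictMono hφ₁).2 hb), hl']
      rfl
    · rw [mem_span_iff_perm_mem hd hi hW, mem_span_iff_perm_mem hd₁
        (W := (φ ∘ Sum.inl) ⁻¹' W) hi fun a ha b hb => hW _ ha _ ((cyclicLT_iff_of_strictMono hφ₁).2 hb), hl]
      rfl
  · rw [kappaDirectSum_mem_span_inr_iff]
    rcases hW with hW | hW
    · rw [mem_span_iff_perm_symm_mem hd hi hW, mem_span_iff_perm_symm_mem hd₂
        (W := (φ ∘ Sum.inr) ⁻¹' W) hi fun a ha b hb => hW _ ha _ ((cyclicLT_iff_of_strictMono hφ₂).2 hb), hr']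
      rfl
    · rw [mem_span_iff_perm_mem hd hi hW, mem_span_iff_perm_mem hd₂
        (W := (φ ∘ Sum.inr) ⁻¹' W) hi fun a ha b hb => hW _ ha _ ((cyclicLT_iff_of_strictMono hφ₂).2 hb), hr]
      rfl

end DirectSum

/-! ### Comparison of dominant exponentials -/

/-- If the columns of `A` and `B` satisfy the same span conditions for upper sets of the weight,
then dominant exponentials for `A` are dominant for `B`. -/
theorem dominantExponentials_subset {N M : ℕ} {κ : Fin M → ℝ} (hκ : StrictMono κ)
    {A B : Matrix (Fin N) (Fin M) ℝ} {s : ℕ → ℝ}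
    (hs : ∀ i, Summable fun n : ℕ => κ i ^ (n + 3) * s n)
    (hB : Submodule.span ℝ (Set.range B.col) = ⊤)
    (h : ∀ p i, A.col i ∈ Submodule.span ℝ (A.col '' {j | weight κ p i < weight κ p j}) ↔
      B.col i ∈ Submodule.span ℝ (B.col '' {j | weight κ p i < weight κ p j})) :
    dominantExponentials κ A s ⊆ dominantExponentials κ B s := by
  intro I hI
  rw [mem_dominantExponentials_iff hκ _ hs] at hI ⊢
  obtain ⟨hIA, p, hp⟩ := hI
  obtain ⟨q, hq, hmax⟩ := exists_injective_weight hκ hp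
  have hAI := mem_range_iff_of_isMax hq hIA fun J hJ => by
    by_cases hJI : J = I
    · rw [hJI]
    · exact (hmax J hJ hJI).le
  have : Finite (Fin N ↪o Fin M) := DFunLike.finite _
  -- Every maximal basis of `B` in the direction `q` has the same greedy description as `I`.
  have unique : ∀ J ∈ matroid B, (∀ K ∈ matroid B, totalWeight κ q K ≤ totalWeight κ q J) →
      J = I := by
    intro J hJ hJmax
    have hr : Set.range J = Set.range I := by
      ext i
      rw [mem_range_iff_of_isMax hq hJ hJmax, hAI, h]
    exact OrderEmbedding.range_inj.1 hr
  obtain ⟨J, hJ, hJmax⟩ :=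
    Set.exists_max_image (matroid B) (totalWeight κ q) (Set.toFinite _) (matroid_nonempty hB)
  obtain rfl := unique J hJ hJmax
  -- A basis tying with the maximum would be maximal too, so uniqueness makes the maximum strict.
  refine ⟨hJ, q, fun K hK hKJ => lt_of_not_ge fun hle => hKJ ?_⟩
  exact unique K hK fun L hL => (hJmax L hL).trans hle

end KPSoliton

theorem corollary3p4
    -- two spectral curves, their roots, and the chosen index sets
    (ℓ : ℕ) (c : ℕ → ℝ) (α₁ α₂ : ℝ) (hα : α₁ ≠ α₂) (r₁ r₂ : Fin ℓ → ℝ)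
    (hr₁ : KPSoliton.IsOrderedRoots ℓ c α₁ r₁) (hr₂ : KPSoliton.IsOrderedRoots ℓ c α₂ r₂)
    (S₁ S₂ : Finset (Fin ℓ)) (m₁ m₂ : ℕ) (hS₁ : S₁.card = m₁) (hS₂ : S₂.card = m₂)
    -- the ordered soliton parameters and the bijection `φ`
    (κ : Fin (m₁ + m₂) → ℝ) (hκ : StrictMono κ) (φ : Fin m₁ ⊕ Fin m₂ ≃ Fin (m₁ + m₂))
    (hφ₁ : ∀ j, κ (φ (Sum.inl j)) = r₁ (S₁.orderEmbOfFin hS₁ j))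
    (hφ₂ : ∀ j, κ (φ (Sum.inr j)) = r₂ (S₂.orderEmbOfFin hS₂ j))
    -- the two totally nonnegative matrices, with derangements as permutations
    (n₁ n₂ : ℕ) (A₁ : Matrix (Fin n₁) (Fin m₁) ℝ) (A₂ : Matrix (Fin n₂) (Fin m₂) ℝ)
    (hA₁ : KPSoliton.IsTotallyNonneg A₁) (hA₂ : KPSoliton.IsTotallyNonneg A₂)
    (hd₁ : KPSoliton.perm A₁ ∈ derangements (Fin m₁))
    (hd₂ : KPSoliton.perm A₂ ∈ derangements (Fin m₂))
    -- the totally nonnegative matrix with the product permutation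
    (A : Matrix (Fin (n₁ + n₂)) (Fin (m₁ + m₂)) ℝ) (hA : KPSoliton.IsTotallyNonneg A)
    (hπ : KPSoliton.perm A =
      φ.permCongr (Equiv.Perm.sumCongr (KPSoliton.perm A₁) (KPSoliton.perm A₂)))
    -- an assignment of the rows of the direct sum, and fixed values of the higher times
    (ρ : Fin n₁ ⊕ Fin n₂ ≃ Fin (n₁ + n₂))
    (s : ℕ → ℝ) (hs : ∀ i, Summable fun n : ℕ => κ i ^ (n + 3) * s n) :
    KPSoliton.dominantExponentials κ A s =
      KPSoliton.dominantExponentials κ (KPSoliton.kappaDirectSum A₁ A₂ φ ρ) s := by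
  -- Roots on one curve are increasing in their index, so `φ` is increasing on each block.
  have mono : ∀ {m : ℕ} {f : Fin m → Fin (m₁ + m₂)} {r : Fin ℓ → ℝ} {e : Fin m ↪o Fin ℓ},
      StrictMono r → (∀ j, κ (f j) = r (e j)) → StrictMono f := fun hr he a b hab =>
    hκ.lt_iff_lt.1 (by rw [he, he]; exact hr (OrderEmbedding.strictMono _ hab))
  have key := fun p i => KPSoliton.mem_span_iff_kappaDirectSum_mem_span ρ (A := A)
    (mono hr₁.1 hφ₁) (mono hr₂.1 hφ₂) hd₁ hd₂ hπ
    (i := i) (W := {j | KPSoliton.weight κ p i < KPSoliton.weight κ p j}) (by simp)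
    (KPSoliton.weight_lt_cyclic hκ p i)
  refine Set.Subset.antisymm ?_ ?_
  · exact KPSoliton.dominantExponentials_subset hκ hs
      (KPSoliton.kappaDirectSum_span_range_col_eq_top φ ρ
        (KPSoliton.span_range_col_eq_top hA₁.1) (KPSoliton.span_range_col_eq_top hA₂.1)) key
  · exact KPSoliton.dominantExponentials_subset hκ hs
      (KPSoliton.span_range_col_eq_top hA.1) fun p i => (key p i).symm
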